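/- Let $q=(q')^3\ge 64$ be a prime power that is a cube, and let $\mathbb F_q$ be the field with $q$ elements. A linear code $C\subseteq\mathbb F_q^n$ of codimension $r$ has covering radius $R$ if $R$ is the least integer such that every vector of $\mathbb F_q^n$ lies within Hamming distance $R$ of a codeword; such a code is called an $[n,n-r]_qR$ code. Its covering density is $V_q(n,R)/q^{r}$, where $V_q(n,R)=\sum_{i=0}^{R}(q-1)^i\binom ni$ is the number of vectors in a Hamming sphere of radius $R$. An infinite family of covering radius $R$ is a sequence of $[n,n-r_n]_qR$ codes $C_n$, one for every length $n\ge n_0$ (for some $n_0\ge R$), with $r_n$ non-decreasing. The code $C_n$ is called supporting if $n=n_0$ or $r_n>r_{n-1}$; every other $C_n$ is assumed to have a parity-check matrix obtained by attaching one column to a parity-check matrix of $C_{n-1}$. The lower asymptotic covering density of the family is $\overline\mu_q(R)=\liminf_{n\to\infty}V_q(n,R)/q^{r_n}$. Theorem. There exists an infinite family of codes over $\mathbb F_q$ of covering radius $3$ whose supporting codes are $[n,n-r]_q3$ codes, exactly one for each $r=3t+1\ge 7$ ($t$ an integer), with $$n=\left(4+\frac{4}{\sqrt[3]{q}}\right)q^{\frac{r-3}{3}},$$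 and whose lower asymptotic covering density satisfies $$\overline\mu_q(3)<\frac{32}{3}+\frac{32}{\sqrt[3]{q}}+\frac{32}{\sqrt[3]{q^2}}-\frac{64}{3q}.$$ -/

import Mathlib

open Filter

/-- The codimension (redundancy) `r` of a linear code `C ⊆ F^n`: an `[n, n - r]` code is a
subspace of `F^n` of dimension `n - r`. -/
noncomputable def codimension {F : Type*} [Field F] {n : ℕ} (C : Submodule F (Fin n → F)) : ℕ :=
  Module.finrank F ((Fin n → F) ⧸ C)

open Classical in
/-- The covering radius of a linear code `C ⊆ F^n`: the least `R` such that the Hamming spheres of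
radius `R` centred at the codewords cover `F^n`. (The set of such `R` contains `n`.) -/
noncomputable def coveringRadius {F : Type*} [Field F] {n : ℕ}
    (C : Submodule F (Fin n → F)) : ℕ :=
  sInf {R : ℕ | ∀ v : Fin n → F, ∃ c ∈ C, hammingDist v c ≤ R}

open Classical in
/-- The number of vectors in a Hamming sphere of radius `R` in `F^n`. -/
noncomputable def sphereSize (F : Type*) [Field F] (n R : ℕ) : ℕ :=
  Nat.card {v : Fin n → F // hammingDist v 0 ≤ R}

/-- `H`, with linearly independent rows, is a parity-check matrix of the code `C`. -/
def IsParityCheck {F : Type*} [Field F] {n r : ℕ} (H : Matrix (Fin r) (Fin n) F)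
    (C : Submodule F (Fin n → F)) : Prop :=
  LinearIndependent F (fun i => H i) ∧ ∀ v : Fin n → F, v ∈ C ↔ H.mulVec v = 0

/-- `C'` is a 1-extension of `C`: a parity-check matrix of `C'` is obtained by attaching one
further column to a parity-check matrix of `C`. -/
def IsOneExtension {F : Type*} [Field F] {n : ℕ} (C : Submodule F (Fin n → F))
    (C' : Submodule F (Fin (n + 1) → F)) : Prop :=
  ∃ (r : ℕ) (H : Matrix (Fin r) (Fin n) F) (c : Fin r → F),
    IsParityCheck H C ∧
    IsParityCheck (Matrix.of fun i => (Fin.snoc (H i) (c i) : Fin (n + 1) → F)) C'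

/-- An infinite family of linear covering codes over `F` with fixed covering radius `R`: one code
`C_n` for every length `n` from some first length `start ≥ R` on, each of covering radius exactly
`R`, with non-decreasing codimensions, where every code with the same codimension as its
predecessor is a 1-extension of that predecessor. (The values of `code` below `start` do not
belong to the family.) -/
structure InfiniteFamily (F : Type*) [Field F] (R : ℕ) where
  start : ℕ
  code : (n : ℕ) → Submodule F (Fin n → F)
  le_start : R ≤ start
  coveringRadius_eq : ∀ n, start ≤ n → coveringRadius (code n) = R
  codimension_le : ∀ n, start ≤ n → codimension (code n) ≤ codimension (code (n + 1))
  filling : ∀ n, start ≤ n → codimension (code (n + 1)) = codimension (code n) →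
    IsOneExtension (code n) (code (n + 1))

namespace InfiniteFamily

/-- The code of length `n` is a supporting code of the family: it is the first code of the family,
or its codimension exceeds that of the preceding code. -/
def IsSupporting {F : Type*} [Field F] {R : ℕ} (A : InfiniteFamily F R) (n : ℕ) : Prop :=
  n = A.start ∨ (A.start < n ∧ codimension (A.code (n - 1)) < codimension (A.code n))

/-- The covering density `V_q(n, R) / q ^ r` of the code of length `n`, `r` its codimension. -/
noncomputable def density {F : Type*} [Field F] {R : ℕ} (A : InfiniteFamily F R) (n : ℕ) : ℝ :=
  (sphereSize F n R : ℝ) / (Nat.card F : ℝ) ^ codimension (A.code n)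

/-- The lower asymptotic covering density: the limit inferior of the covering densities of all
the codes of the family, taken in the extended reals. -/
noncomputable def lowerDensity {F : Type*} [Field F] {R : ℕ} (A : InfiniteFamily F R) : EReal :=
  liminf (fun n : ℕ => ((A.density n : ℝ) : EReal)) atTop

end InfiniteFamily

/-! Let `K` be the subfield of order `q'`, so that `F` has degree 3 over `K`. The starting point is
a set of `4 * (q' + 1)` points of `PG(3, F)`: the `K`-rational points of four lines. In `F² ⊕ F²`
these are the two summands, the graph of the identity and the graph of a matrix over `K` without
eigenvalues in `K`.

The four coordinates of any vector are dependent over `K`, so the vector lies in a plane defined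
over `K`. Such a plane either contains one of the first two lines or is spanned by its rational
intersections with three of the four lines (`exists_three_sublinePoints`). The representation can
then be adjusted to use three distinct points with nonzero coefficients
(`isProperTriple_sublinePoint`).

Properness permits lifting to codimension `3 * m + 4`: the point `g j` is replaced by all columns
`(g j, ξ, β j ξ, (β j)² ξ)` with distinct scalars `β j`. Three distinct points with nonzero
coefficients leave an invertible Vandermonde system for the three vectors `ξ`
(`concatColumn_three`). Radius 2 is excluded by counting (`exists_not_two`). The resulting length is
`N * q ^ m` with `N = 4 * (q' + 1)`; lengths up to the next such value are filled by repeating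
columns. Along these lengths the density tends to `(q - 1)³ N³ / (6 q⁴)`, which `limit_density_lt`
compares with the stated bound. -/

/-- A finite field whose order is a cube `q' ^ 3` is a cubic extension of a field of order `q'`. -/
theorem exists_cubic_subfield (F : Type*) [Field F] [Finite F] (q' : ℕ)
    (hF : Nat.card F = q' ^ 3) :
    ∃ (K : Type) (_ : Field K) (_ : Finite K) (_ : Algebra K F),
      Nat.card K = q' ∧ Module.finrank K F = 3 := by
  obtain ⟨p, hchar⟩ := CharP.exists F
  have hp : p.Prime := CharP.char_prime_of_ne_zero F (CharP.char_ne_zero_of_finite F p)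
  have : Fact p.Prime := ⟨hp⟩
  let _ : Algebra (ZMod p) F := ZMod.algebra F p
  have hpow := FiniteField.pow_finrank_eq_natCard p F
  obtain ⟨k, -, hk⟩ : ∃ k ≤ Module.finrank (ZMod p) F, q' = p ^ k :=
    (Nat.dvd_prime_pow hp).1 (by rw [hpow, hF]; exact dvd_pow_self _ (by norm_num))
  -- Since `k` divides the degree of `F`, the field of order `p ^ k` embeds in `F`.
  have hfin : Module.finrank (ZMod p) F = k * 3 := by
    apply Nat.pow_right_injective hp.two_le
    simp only
    rw [hpow, hF, hk, pow_mul]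
  have hk0 : k ≠ 0 := by
    rintro rfl
    have := Module.finrank_pos (R := ZMod p) (M := F)
    omega
  obtain ⟨f⟩ := FiniteField.nonempty_algHom_of_finrank_dvd (F := ZMod p) (K := GaloisField p k)
    (L := F) (by rw [GaloisField.finrank p hk0, hfin]; exact dvd_mul_right _ _)
  let _ : Algebra (GaloisField p k) F := f.toRingHom.toAlgebra
  have hcard : Nat.card (GaloisField p k) = q' := by rw [GaloisField.card p k hk0, hk]
  refine ⟨GaloisField p k, inferInstance, inferInstance, inferInstance, hcard, ?_⟩
  have h := Module.natCard_eq_pow_finrank (K := GaloisField p k) (V := F)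
  rw [hF, hcard] at h
  exact (Nat.pow_right_injective (by rw [hk]; exact Nat.one_lt_pow hk0 hp.one_lt) h).symm

/-- A finite field has an irreducible monic quadratic polynomial `X ^ 2 - X - d`. -/
theorem exists_forall_sq_sub_ne (K : Type*) [Field K] [Finite K] : ∃ d : K, ∀ x : K, x ^ 2 - x ≠ d := by
  by_contra! h
  -- `x ^ 2 - x` takes the same value at 0 and 1, so on a finite set it cannot be onto. This works
  -- in characteristic 2 as well.
  have hinj := Finite.injective_iff_surjective.2 (show Function.Surjective fun x : K => x ^ 2 - x from h)
  exact zero_ne_one (hinj (show (0 : K) ^ 2 - 0 = 1 ^ 2 - 1 by ring))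

/-- A zero with `t ≠ 0` would make `s / t` a root of `X ^ 2 - X - d`. -/
theorem anisotropic_of_forall_sq_sub_ne {K : Type*} [Field K] {d : K} (hd : ∀ x : K, x ^ 2 - x ≠ d)
    {s t : K} (h : s ^ 2 - s * t - d * t ^ 2 = 0) : s = 0 ∧ t = 0 := by
  by_cases ht : t = 0
  · subst ht
    exact ⟨by simpa using h, rfl⟩
  · exact absurd (by field_simp; linear_combination h) (hd (s / t))

/-! ### Rational points on four lines of `PG(3, F)` -/

section FourLines

variable {K F : Type*} [Field K] [Field F] [Algebra K F]

/-- Four lines of the projective space `PG(3, F)`, parametrised by pairs of coordinates. -/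
def fourLines (d : F) (i : Fin 4) (x y : F) : Fin 4 → F :=
  ![![x, y, 0, 0], ![0, 0, x, y], ![x, y, x, y], ![x, y, y, d * x - y]] i

theorem fourLines_smul_add (d : F) (i : Fin 4) (a b x y x' y' : F) :
    a • fourLines d i x y + b • fourLines d i x' y' =
      fourLines d i (a * x + b * x') (a * y + b * y') := by
  fin_cases i <;> ext j <;> fin_cases j <;> (simp [fourLines]; try ring)

theorem fourLines_smul (d : F) (i : Fin 4) (a x y : F) :
    a • fourLines d i x y = fourLines d i (a * x) (a * y) := by
  simpa using fourLines_smul_add d i a 0 x y 0 0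

/-- The points of the four lines that are rational over the subfield `K`, the projective line
over `K` being identified with `Option K`. -/
def sublinePoint (F : Type*) [Field F] [Algebra K F] (d : K) : Fin 4 × Option K → Fin 4 → F
  | (i, none) => fourLines (algebraMap K F d) i 0 1
  | (i, some a) => fourLines (algebraMap K F d) i 1 (algebraMap K F a)

theorem exists_smul_sublinePoint (d : K) (i : Fin 4) (a b : K) :
    ∃ (p : Option K) (c : F), fourLines (algebraMap K F d) i (algebraMap K F a) (algebraMap K F b) =
      c • sublinePoint F d (i, p) := by
  by_cases ha : a = 0
  · exact ⟨none, algebraMap K F b, by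
      simp only [sublinePoint, fourLines_smul, ha, map_zero, mul_zero, mul_one]⟩
  · refine ⟨some (b / a), algebraMap K F a, ?_⟩
    simp only [sublinePoint, fourLines_smul, mul_one, ← map_mul]
    rw [mul_div_cancel₀ _ ha]

/-- Every rational point of a line is a combination of two others. -/
theorem sublinePoint_split (d : K) (i : Fin 4) (p : Option K) :
    ∃ p₁ p₂ : Option K, p₁ ≠ p₂ ∧ ∃ a b : F, a ≠ 0 ∧ b ≠ 0 ∧
      sublinePoint F d (i, p) = a • sublinePoint F d (i, p₁) + b • sublinePoint F d (i, p₂) := by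
  cases p with
  | none =>
    refine ⟨some 1, some 0, by simp, 1, -1, one_ne_zero, neg_ne_zero.2 one_ne_zero, ?_⟩
    simp [sublinePoint, fourLines_smul_add, -one_smul, -neg_smul]
  | some c =>
    refine ⟨some (c + 1), none, by simp, 1, -1, one_ne_zero, neg_ne_zero.2 one_ne_zero, ?_⟩
    simp [sublinePoint, fourLines_smul_add, -one_smul, -neg_smul]

/-- `v` is a combination, with nonzero coefficients, of three members of the family `h`. -/
def IsProperTriple {J V : Type*} [AddCommGroup V] [Module F V] (h : J → V) (v : V) : Prop :=
  ∃ j₁ j₂ j₃ : J, j₁ ≠ j₂ ∧ j₁ ≠ j₃ ∧ j₂ ≠ j₃ ∧ ∃ c₁ c₂ c₃ : F, c₁ ≠ 0 ∧ c₂ ≠ 0 ∧ c₃ ≠ 0 ∧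
    v = c₁ • h j₁ + c₂ • h j₂ + c₃ • h j₃

/-- The points `(0, 1)`, `(1, 0)`, `(1, 1)` of the line suffice, with coefficients `y - c`, `x - c`,
`c`; four field elements leave room for a `c` making all three nonzero. The zero vector is included.
-/
theorem isProperTriple_fourLines [Finite F] (hF : 4 ≤ Nat.card F) (d : K) (i : Fin 4) (x y : F) :
    IsProperTriple (F := F) (sublinePoint F d) (fourLines (algebraMap K F d) i x y) := by
  classical
  obtain ⟨c, hc⟩ : ∃ c : F, c ∉ ({0, x, y} : Finset F) := by
    have := Fintype.ofFinite F
    by_contra! h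
    have h3 : ({0, x, y} : Finset F).card ≤ 3 := Finset.card_le_three
    rw [Finset.eq_univ_iff_forall.2 h, Finset.card_univ, ← Nat.card_eq_fintype_card] at h3
    omega
  simp only [Finset.mem_insert, Finset.mem_singleton, not_or] at hc
  refine ⟨(i, none), (i, some 0), (i, some 1), by simp, by simp, by simp, y - c, x - c, c,
    sub_ne_zero.2 (Ne.symm hc.2.2), sub_ne_zero.2 (Ne.symm hc.2.1), hc.1, ?_⟩
  simp only [sublinePoint, map_zero, map_one, fourLines_smul_add]
  rw [← one_smul F (fourLines _ _ ((y - c) * 0 + _) _), fourLines_smul_add]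
  congr 1 <;> ring

theorem sublinePoint_eq_fourLines (d : K) (i : Fin 4) (p : Option K) :
    ∃ x y : F, sublinePoint F d (i, p) = fourLines (algebraMap K F d) i x y := by
  cases p <;> exact ⟨_, _, rfl⟩

/-- Degenerate cases fall back to a vector of a single line. Otherwise the points lie on different
lines, and splitting one of them along its own line creates no coincidence with the other. -/
theorem isProperTriple_of_two [Finite F] (hF : 4 ≤ Nat.card F) (d : K) (j₁ j₂ : Fin 4 × Option K)
    (a b : F) :
    IsProperTriple (F := F) (sublinePoint F d)
      (a • sublinePoint F d j₁ + b • sublinePoint F d j₂) := by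
  obtain ⟨i₁, p₁⟩ := j₁
  obtain ⟨i₂, p₂⟩ := j₂
  obtain ⟨x₁, y₁, h₁⟩ := sublinePoint_eq_fourLines (F := F) d i₁ p₁
  obtain ⟨x₂, y₂, h₂⟩ := sublinePoint_eq_fourLines (F := F) d i₂ p₂
  by_cases hi : i₁ = i₂
  · subst hi
    rw [h₁, h₂, fourLines_smul_add]
    exact isProperTriple_fourLines hF d _ _ _
  by_cases ha : a = 0
  · rw [ha, zero_smul, zero_add, h₂, fourLines_smul]
    exact isProperTriple_fourLines hF d _ _ _
  by_cases hb : b = 0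
  · rw [hb, zero_smul, add_zero, h₁, fourLines_smul]
    exact isProperTriple_fourLines hF d _ _ _
  obtain ⟨s, t, hst, c, e, hc, he, h⟩ := sublinePoint_split (F := F) d i₁ p₁
  refine ⟨(i₁, s), (i₁, t), (i₂, p₂), by simpa using hst, by simp [hi], by simp [hi],
    a * c, a * e, b, mul_ne_zero ha hc, mul_ne_zero ha he, hb, ?_⟩
  rw [h, smul_add, smul_smul, smul_smul]

theorem isProperTriple_of_three [Finite F] (hF : 4 ≤ Nat.card F) (d : K)
    (j₁ j₂ j₃ : Fin 4 × Option K) (a b c : F) :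
    IsProperTriple (F := F) (sublinePoint F d)
      (a • sublinePoint F d j₁ + b • sublinePoint F d j₂ + c • sublinePoint F d j₃) := by
  by_cases h12 : j₁ = j₂
  · subst h12
    rw [← add_smul]
    exact isProperTriple_of_two hF d _ _ _ _
  by_cases h13 : j₁ = j₃
  · subst h13
    rw [add_right_comm, ← add_smul]
    exact isProperTriple_of_two hF d _ _ _ _
  by_cases h23 : j₂ = j₃
  · subst h23
    rw [add_assoc, ← add_smul]
    exact isProperTriple_of_two hF d _ _ _ _
  by_cases ha : a = 0
  · rw [ha, zero_smul, zero_add]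
    exact isProperTriple_of_two hF d _ _ _ _
  by_cases hb : b = 0
  · rw [hb, zero_smul, add_zero]
    exact isProperTriple_of_two hF d _ _ _ _
  by_cases hc : c = 0
  · rw [hc, zero_smul, add_zero]
    exact isProperTriple_of_two hF d _ _ _ _
  exact ⟨j₁, j₂, j₃, h12, h13, h23, a, b, c, ha, hb, hc, rfl⟩

/-- A vector of the plane orthogonal to `(f₁, f₂) ≠ 0` is a multiple of `(-f₂, f₁)`. -/
theorem exists_eq_of_orthogonal {f₁ f₂ x₁ x₂ : F} (hf : ¬(f₁ = 0 ∧ f₂ = 0))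
    (h : f₁ * x₁ + f₂ * x₂ = 0) : ∃ a : F, x₁ = a * -f₂ ∧ x₂ = a * f₁ := by
  by_cases h1 : f₁ = 0
  · subst h1
    have h2 : f₂ ≠ 0 := fun h2 => hf ⟨rfl, h2⟩
    refine ⟨-(x₁ / f₂), by field_simp, ?_⟩
    have : f₂ * x₂ = 0 := by simpa using h
    simpa [h2] using this
  · refine ⟨x₂ / f₁, ?_, by field_simp⟩
    field_simp
    linear_combination h

/-- Every vector orthogonal to a nonzero vector over the subfield is a combination of three
rational points of the four lines. -/
theorem exists_three_sublinePoints {d : K} (hd : ∀ x : K, x ^ 2 - x ≠ d) {f₁ f₂ g₁ g₂ : K}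
    (hfg : ¬((f₁ = 0 ∧ f₂ = 0) ∧ (g₁ = 0 ∧ g₂ = 0))) {v : Fin 4 → F}
    (hv : algebraMap K F f₁ * v 0 + algebraMap K F f₂ * v 1 + algebraMap K F g₁ * v 2 +
      algebraMap K F g₂ * v 3 = 0) :
    ∃ (j₁ j₂ j₃ : Fin 4 × Option K) (a b c : F),
      v = a • sublinePoint F d j₁ + b • sublinePoint F d j₂ + c • sublinePoint F d j₃ := by
  have key : ∀ (i₁ i₂ i₃ : Fin 4) (a₁ b₁ a₂ b₂ a₃ b₃ : K) (a b c : F),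
      v = a • fourLines (algebraMap K F d) i₁ (algebraMap K F a₁) (algebraMap K F b₁)
        + b • fourLines (algebraMap K F d) i₂ (algebraMap K F a₂) (algebraMap K F b₂)
        + c • fourLines (algebraMap K F d) i₃ (algebraMap K F a₃) (algebraMap K F b₃) →
      ∃ (j₁ j₂ j₃ : Fin 4 × Option K) (a b c : F),
        v = a • sublinePoint F d j₁ + b • sublinePoint F d j₂ + c • sublinePoint F d j₃ := by
    intro i₁ i₂ i₃ a₁ b₁ a₂ b₂ a₃ b₃ a b c h
    obtain ⟨p₁, c₁, h₁⟩ := exists_smul_sublinePoint (F := F) d i₁ a₁ b₁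
    obtain ⟨p₂, c₂, h₂⟩ := exists_smul_sublinePoint (F := F) d i₂ a₂ b₂
    obtain ⟨p₃, c₃, h₃⟩ := exists_smul_sublinePoint (F := F) d i₃ a₃ b₃
    exact ⟨(i₁, p₁), (i₂, p₂), (i₃, p₃), a * c₁, b * c₂, c * c₃, by
      rw [h, h₁, h₂, h₃, smul_smul, smul_smul, smul_smul]⟩
  have inj : ∀ {a b : K}, ¬(a = 0 ∧ b = 0) → ¬(algebraMap K F a = 0 ∧ algebraMap K F b = 0) := by
    intro a b h
    simpa using h
  by_cases hf : f₁ = 0 ∧ f₂ = 0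
  · have hg : ¬(g₁ = 0 ∧ g₂ = 0) := fun hg => hfg ⟨hf, hg⟩
    obtain ⟨a, h2, h3⟩ := exists_eq_of_orthogonal (x₁ := v 2) (x₂ := v 3) (inj hg)
      (by simpa [hf.1, hf.2] using hv)
    refine key 0 0 1 1 0 0 1 (-g₂) g₁ (v 0) (v 1) a ?_
    ext j
    fin_cases j <;> simp [fourLines, h2, h3]
  by_cases hg : g₁ = 0 ∧ g₂ = 0
  · obtain ⟨a, h2, h3⟩ := exists_eq_of_orthogonal (x₁ := v 0) (x₂ := v 1) (inj hf)
      (by simpa [hg.1, hg.2] using hv)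
    refine key 1 1 0 1 0 0 1 (-f₂) f₁ (v 2) (v 3) a ?_
    ext j
    fin_cases j <;> simp [fourLines, h2, h3]
  have hf' := inj hf
  have hg' := inj hg
  by_cases hD : f₁ * g₂ - f₂ * g₁ = 0
  · have hE : f₂ * (f₁ + d * g₂) - f₁ * (f₂ + g₁ - g₂) ≠ 0 := by
      intro h0
      have hN : f₁ ^ 2 - f₁ * f₂ - d * f₂ ^ 2 ≠ 0 := fun h =>
        hf (anisotropic_of_forall_sq_sub_ne hd h)
      refine hg ⟨(mul_eq_zero_iff_right hN).1 ?_, (mul_eq_zero_iff_right hN).1 ?_⟩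
      · linear_combination -f₁ * h0 + (f₁ + d * f₂) * hD
      · linear_combination -f₂ * h0 + f₁ * hD
    have hE' : algebraMap K F (f₂ * (f₁ + d * g₂) - f₁ * (f₂ + g₁ - g₂)) ≠ 0 :=
      (map_ne_zero (algebraMap K F)).2 hE
    obtain ⟨c, hc⟩ : ∃ c : F, c * algebraMap K F (f₂ * (f₁ + d * g₂) - f₁ * (f₂ + g₁ - g₂)) =
      algebraMap K F f₁ * v 0 + algebraMap K F f₂ * v 1 := ⟨_, div_mul_cancel₀ _ hE'⟩
    simp only [map_sub, map_mul, map_add] at hc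
    have hD' : algebraMap K F f₁ * algebraMap K F g₂ - algebraMap K F f₂ * algebraMap K F g₁ = 0 := by
      rw [← map_mul, ← map_mul, ← map_sub, hD, map_zero]
    obtain ⟨a, h0, h1⟩ := exists_eq_of_orthogonal
      (x₁ := v 0 + c * algebraMap K F (f₂ + g₁ - g₂))
      (x₂ := v 1 - c * algebraMap K F (f₁ + d * g₂)) hf' (by
        simp only [map_sub, map_mul, map_add]
        linear_combination -hc)
    obtain ⟨b, h2, h3⟩ := exists_eq_of_orthogonal
      (x₁ := v 2 - c * algebraMap K F (f₁ + d * g₂))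
      (x₂ := v 3 - c * (algebraMap K F d * -algebraMap K F (f₂ + g₁ - g₂)
        - algebraMap K F (f₁ + d * g₂))) hg' (by
        simp only [map_sub, map_mul, map_add]
        linear_combination hv + hc)
    refine key 0 1 3 (-f₂) f₁ (-g₂) g₁ (-(f₂ + g₁ - g₂)) (f₁ + d * g₂) a b c ?_
    simp only [map_sub, map_mul, map_add] at h0 h1 h2 h3
    ext j
    fin_cases j <;> simp [fourLines]
    · linear_combination h0
    · linear_combination h1
    · linear_combination h2
    · linear_combination h3
  · have hD' : algebraMap K F f₁ * algebraMap K F g₂ - algebraMap K F f₂ * algebraMap K F g₁ ≠ 0 := by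
      rw [← map_mul, ← map_mul, ← map_sub]
      exact (map_ne_zero (algebraMap K F)).2 hD
    obtain ⟨c, hc⟩ : ∃ c : F, c * (algebraMap K F f₁ * algebraMap K F g₂ - algebraMap K F f₂ * algebraMap K F g₁) =
        -(algebraMap K F f₁ * v 0 + algebraMap K F f₂ * v 1) := ⟨_, div_mul_cancel₀ _ hD'⟩
    obtain ⟨a, h0, h1⟩ := exists_eq_of_orthogonal
      (x₁ := v 0 + c * (algebraMap K F f₂ + algebraMap K F g₂))
      (x₂ := v 1 - c * (algebraMap K F f₁ + algebraMap K F g₁)) hf' (by linear_combination hc)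
    obtain ⟨b, h2, h3⟩ := exists_eq_of_orthogonal
      (x₁ := v 2 + c * (algebraMap K F f₂ + algebraMap K F g₂))
      (x₂ := v 3 - c * (algebraMap K F f₁ + algebraMap K F g₁)) hg' (by linear_combination hv - hc)
    refine key 0 1 2 (-f₂) f₁ (-g₂) g₁ (-(f₂ + g₂)) (f₁ + g₁) a b c ?_
    ext j
    fin_cases j <;> simp [fourLines]
    · linear_combination h0
    · linear_combination h1
    · linear_combination h2
    · linear_combination h3

/-- If `F` is a cubic extension of `K`, every vector is a combination, with nonzero coefficients,
of three rational points of the four lines. -/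
theorem isProperTriple_sublinePoint [Finite F] (hF : 4 ≤ Nat.card F)
    (hKF : Module.finrank K F = 3) {d : K} (hd : ∀ x : K, x ^ 2 - x ≠ d) (v : Fin 4 → F) :
    IsProperTriple (F := F) (sublinePoint F d) v := by
  have : Module.Finite K F := Module.finite_of_finrank_pos (by omega)
  -- Four elements of a 3-dimensional `K`-space: a dependency is a `K`-rational plane through `v`.
  have hdep : ¬LinearIndependent K v := fun h => by
    have := h.fintype_card_le_finrank
    simp [hKF] at this
  obtain ⟨g, hg, i, hi⟩ := Fintype.not_linearIndependent_iff.1 hdep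
  simp only [Fin.sum_univ_four, Algebra.smul_def] at hg
  obtain ⟨j₁, j₂, j₃, a, b, c, h⟩ := exists_three_sublinePoints hd (f₁ := g 0) (f₂ := g 1)
    (g₁ := g 2) (g₂ := g 3) (by
      rintro ⟨⟨h0, h1⟩, h2, h3⟩
      fin_cases i <;> simp_all) hg
  rw [h]
  exact isProperTriple_of_three hF d _ _ _ _ _ _

end FourLines

/-! ### Codes given by a sequence of parity-check columns -/

section ColumnCodes

variable {F : Type*} [Field F] {V : Type*} [AddCommGroup V] [Module F V]

/-- The syndrome map of length `n` attached to a sequence of columns. -/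
noncomputable def syndromeMap (h : ℕ → V) (n : ℕ) : (Fin n → F) →ₗ[F] V :=
  Fintype.linearCombination F fun j : Fin n => h j

theorem syndromeMap_apply (h : ℕ → V) (n : ℕ) (v : Fin n → F) :
    syndromeMap h n v = ∑ j, v j • h j :=
  Fintype.linearCombination_apply ..

theorem codimension_ker_of_surjective {n : ℕ} {Φ : (Fin n → F) →ₗ[F] V}
    (hΦ : Function.Surjective Φ) : codimension (LinearMap.ker Φ) = Module.finrank F V :=
  (Φ.quotKerEquivOfSurjective hΦ).finrank_eq

theorem syndromeMap_three (h : ℕ → V) {n : ℕ} (j₁ j₂ j₃ : Fin n) (a b c : F) :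
    syndromeMap h n (Pi.single j₁ a + Pi.single j₂ b + Pi.single j₃ c : Fin n → F) =
      a • h j₁ + b • h j₂ + c • h j₃ := by
  simp [syndromeMap, Fintype.linearCombination_apply_single]

open Classical in
theorem hammingDist_eq_hammingNorm_sub {n : ℕ} (v c : Fin n → F) :
    hammingDist v c = hammingNorm (v - c) := by
  rw [hammingDist_comm, hammingDist_eq_hammingNorm, neg_add_eq_sub]

open Classical in
theorem hammingNorm_three_le {n : ℕ} (j₁ j₂ j₃ : Fin n) (a b c : F) :
    hammingNorm (Pi.single j₁ a + Pi.single j₂ b + Pi.single j₃ c : Fin n → F) ≤ 3 := by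
  refine le_trans (Finset.card_le_card (t := {j₁, j₂, j₃}) fun j hj => ?_) Finset.card_le_three
  by_contra h
  simp only [Finset.mem_insert, Finset.mem_singleton, not_or] at h
  simp [Pi.single_eq_of_ne h.1, Pi.single_eq_of_ne h.2.1, Pi.single_eq_of_ne h.2.2] at hj

open Classical in
theorem exists_two_of_hammingNorm_le (h : ℕ → V) {n : ℕ} (hn : 0 < n) (e : Fin n → F)
    (he : hammingNorm e ≤ 2) :
    ∃ (i j : Fin n) (a b : F), syndromeMap h n e = a • h i + b • h j := by
  have hsum : syndromeMap h n e = ∑ j with e j ≠ 0, e j • h j := by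
    rw [syndromeMap_apply, Finset.sum_filter_of_ne]
    intro j _ hj h0
    exact hj (by rw [h0, zero_smul])
  rw [hsum]
  unfold hammingNorm at he
  generalize ({j | e j ≠ 0} : Finset (Fin n)) = s at he
  have : s.card = 0 ∨ s.card = 1 ∨ s.card = 2 := by omega
  rcases this with h0 | h1 | h2
  · rw [Finset.card_eq_zero.1 h0]
    exact ⟨⟨0, hn⟩, ⟨0, hn⟩, 0, 0, by simp⟩
  · obtain ⟨i, rfl⟩ := Finset.card_eq_one.1 h1
    exact ⟨i, i, e i, 0, by simp⟩
  · obtain ⟨i, j, hij, rfl⟩ := Finset.card_eq_two.1 h2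
    exact ⟨i, j, e i, e j, Finset.sum_pair hij⟩

theorem syndromeMap_surjective {h : ℕ → V} {n : ℕ}
    (hcov : ∀ s : V, ∃ (j₁ j₂ j₃ : Fin n) (a b c : F), s = a • h j₁ + b • h j₂ + c • h j₃) :
    Function.Surjective (syndromeMap (F := F) h n) := fun s => by
  obtain ⟨j₁, j₂, j₃, a, b, c, hs⟩ := hcov s
  exact ⟨_, (syndromeMap_three h j₁ j₂ j₃ a b c).trans hs.symm⟩

/-- The code defined by a sequence of columns has covering radius `3` if all syndromes are
combinations of three columns but not all are combinations of two. -/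
theorem coveringRadius_ker_syndromeMap {h : ℕ → V} {n : ℕ}
    (hcov : ∀ s : V, ∃ (j₁ j₂ j₃ : Fin n) (a b c : F), s = a • h j₁ + b • h j₂ + c • h j₃)
    (hnot : ∃ s : V, ∀ (i j : Fin n) (a b : F), s ≠ a • h i + b • h j) :
    coveringRadius (LinearMap.ker (syndromeMap (F := F) h n)) = 3 := by
  classical
  unfold coveringRadius
  have hmem : 3 ∈ {R : ℕ | ∀ v : Fin n → F, ∃ c ∈ LinearMap.ker (syndromeMap (F := F) h n),
      hammingDist v c ≤ R} := by
    intro v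
    obtain ⟨j₁, j₂, j₃, a, b, c, hs⟩ := hcov (syndromeMap h n v)
    refine ⟨v - (Pi.single j₁ a + Pi.single j₂ b + Pi.single j₃ c), ?_, ?_⟩
    · rw [LinearMap.mem_ker, map_sub, syndromeMap_three, hs, sub_self]
    · rw [hammingDist_eq_hammingNorm_sub, sub_sub_cancel]
      convert! hammingNorm_three_le j₁ j₂ j₃ a b c
  refine le_antisymm (Nat.sInf_le (by convert! hmem)) (le_csInf ⟨3, by convert! hmem⟩ ?_)
  intro R hR
  by_contra hlt
  obtain ⟨s, hs⟩ := hnot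
  obtain ⟨v, rfl⟩ := syndromeMap_surjective hcov s
  have hn : 0 < n := by
    obtain ⟨j, -⟩ := hcov 0
    exact j.pos
  obtain ⟨c, hc, hvc⟩ := hR v
  obtain ⟨i, j, a, b, hab⟩ := exists_two_of_hammingNorm_le h hn (v - c) (by
    rw [← hammingDist_eq_hammingNorm_sub]
    exact hvc.trans (by omega))
  rw [map_sub, LinearMap.mem_ker.1 hc, sub_zero] at hab
  exact hs i j a b hab

/-- A row relation `x` is orthogonal to every `H v`, hence to the whole space. -/
theorem linearIndependent_rows_of_surjective {r n : ℕ} (H : Matrix (Fin r) (Fin n) F)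
    (hH : Function.Surjective H.mulVec) : LinearIndependent F fun i => H i := by
  refine Matrix.vecMul_injective_iff.1 ?_
  refine (injective_iff_map_eq_zero (Matrix.vecMulLinear H)).2 fun x hx => ?_
  refine dotProduct_eq_zero x fun w => ?_
  obtain ⟨v, rfl⟩ := hH w
  rw [Matrix.dotProduct_mulVec]
  simp only [Matrix.vecMulLinear_apply] at hx
  rw [hx, zero_dotProduct]

theorem isParityCheck_ker_syndromeMap {r : ℕ} (h : ℕ → Fin r → F) (n : ℕ)
    (hsurj : Function.Surjective (syndromeMap (F := F) h n)) :
    IsParityCheck (Matrix.of fun i (j : Fin n) => h j i)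
      (LinearMap.ker (syndromeMap (F := F) h n)) := by
  have hmul : ∀ v : Fin n → F,
      (Matrix.of fun i (j : Fin n) => h j i).mulVec v = syndromeMap h n v := by
    intro v
    ext i
    simp [syndromeMap_apply, Matrix.mulVec, dotProduct, mul_comm]
  refine ⟨linearIndependent_rows_of_surjective _ fun s => ?_, fun v => ?_⟩
  · obtain ⟨v, hv⟩ := hsurj s
    exact ⟨v, (hmul v).trans hv⟩
  · rw [LinearMap.mem_ker, hmul]

theorem isOneExtension_ker_syndromeMap {r : ℕ} (h : ℕ → Fin r → F) (n : ℕ)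
    (h₁ : Function.Surjective (syndromeMap (F := F) h n))
    (h₂ : Function.Surjective (syndromeMap (F := F) h (n + 1))) :
    IsOneExtension (LinearMap.ker (syndromeMap (F := F) h n))
      (LinearMap.ker (syndromeMap (F := F) h (n + 1))) := by
  refine ⟨r, _, h n, isParityCheck_ker_syndromeMap h n h₁, ?_⟩
  convert! isParityCheck_ker_syndromeMap h (n + 1) h₂ using 1
  ext i j
  refine Fin.lastCases ?_ (fun j => ?_) j <;> simp

end ColumnCodes

/-! ### Lifting the point set to higher codimension -/

section Concatenation

variable {F : Type*} [Field F] {J : Type*}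

/-- A system of three equations with Vandermonde matrix is solvable. -/
theorem exists_vandermonde_three {b₁ b₂ b₃ c₁ c₂ c₃ : F} (h12 : b₁ ≠ b₂) (h13 : b₁ ≠ b₃)
    (h23 : b₂ ≠ b₃) (hc₁ : c₁ ≠ 0) (hc₂ : c₂ ≠ 0) (hc₃ : c₃ ≠ 0) (u₀ u₁ u₂ : F) :
    ∃ x₁ x₂ x₃ : F, u₀ = c₁ * x₁ + c₂ * x₂ + c₃ * x₃ ∧
      u₁ = c₁ * (b₁ * x₁) + c₂ * (b₂ * x₂) + c₃ * (b₃ * x₃) ∧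
      u₂ = c₁ * (b₁ ^ 2 * x₁) + c₂ * (b₂ ^ 2 * x₂) + c₃ * (b₃ ^ 2 * x₃) := by
  have e12 := sub_ne_zero.2 h12
  have e13 := sub_ne_zero.2 h13
  have e23 := sub_ne_zero.2 h23
  -- Lagrange interpolation: combining the equations with the coefficients of `(X - b₂) * (X - b₃)`
  -- isolates `x₁`, and similarly for the others.
  refine ⟨(u₂ - (b₂ + b₃) * u₁ + b₂ * b₃ * u₀) / (c₁ * ((b₁ - b₂) * (b₁ - b₃))),
    -(u₂ - (b₁ + b₃) * u₁ + b₁ * b₃ * u₀) / (c₂ * ((b₁ - b₂) * (b₂ - b₃))),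
    (u₂ - (b₁ + b₂) * u₁ + b₁ * b₂ * u₀) / (c₃ * ((b₁ - b₃) * (b₂ - b₃))), ?_, ?_, ?_⟩ <;>
  · field_simp
    ring

/-- The columns of the concatenation with the maps `ξ ↦ (ξ, β ξ, β ^ 2 ξ)`. -/
def concatColumn {W : Type*} (g : J → W) (β : J → F) {m : ℕ} (x : J × (Fin m → F)) :
    W × (Fin m → F) × (Fin m → F) × (Fin m → F) :=
  (g x.1, x.2, β x.1 • x.2, β x.1 ^ 2 • x.2)

/-- A proper triple for `w` fixes the points and coefficients; the vectors attached to them remain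
free and are found coordinate by coordinate from the Vandermonde system. -/
theorem concatColumn_three {W : Type*} [AddCommGroup W] [Module F W] {g : J → W} {β : J → F}
    (hβ : Function.Injective β) (hg : ∀ w : W, IsProperTriple (F := F) g w) {m : ℕ}
    (s : W × (Fin m → F) × (Fin m → F) × (Fin m → F)) :
    ∃ (x₁ x₂ x₃ : J × (Fin m → F)) (a b c : F),
      s = a • concatColumn g β x₁ + b • concatColumn g β x₂ + c • concatColumn g β x₃ := by
  obtain ⟨w, u₀, u₁, u₂⟩ := s
  obtain ⟨j₁, j₂, j₃, h12, h13, h23, a, b, c, ha, hb, hc, hw⟩ := hg w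
  choose x₁ x₂ x₃ h₀ h₁ h₂ using fun k => exists_vandermonde_three (hβ.ne h12) (hβ.ne h13)
    (hβ.ne h23) ha hb hc (u₀ k) (u₁ k) (u₂ k)
  refine ⟨(j₁, x₁), (j₂, x₂), (j₃, x₃), a, b, c, ?_⟩
  ext k
  · simp [concatColumn, hw]
  · simpa [concatColumn] using h₀ k
  · simpa [concatColumn] using h₁ k
  · simpa [concatColumn] using h₂ k

theorem finrank_concat (F : Type*) [Field F] (m : ℕ) :
    Module.finrank F ((Fin 4 → F) × (Fin m → F) × (Fin m → F) × (Fin m → F)) = 3 * m + 4 := by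
  simp only [Module.finrank_prod, Module.finrank_fin_fun]
  ring

/-- In a space of large cardinality some vector is not a combination of two columns. -/
theorem exists_not_two [Finite F] {X V : Type*} [Finite X] [AddCommGroup V] [Module F V]
    [Module.Finite F V] (g : X → V) (h : (Nat.card F * Nat.card X) ^ 2 < Nat.card V) :
    ∃ s : V, ∀ (x y : X) (a b : F), s ≠ a • g x + b • g y := by
  by_contra! hall
  have hsurj : Function.Surjective fun z : (F × X) × (F × X) =>
      z.1.1 • g z.1.2 + z.2.1 • g z.2.2 := fun s => by
    obtain ⟨x, y, a, b, hs⟩ := hall s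
    exact ⟨((a, x), (b, y)), hs.symm⟩
  have := Nat.card_le_card_of_surjective _ hsurj
  rw [Nat.card_prod, Nat.card_prod, ← sq] at this
  omega

/-- Sequences of columns whose codes have covering radius `3` and codimension `3 * m + 4` from
the length `N * q ^ m` on. -/
theorem exists_columns [Finite F] [Finite J] {g : J → Fin 4 → F}
    (hg : ∀ w, IsProperTriple (F := F) g w) (hJ : Nat.card J ≤ Nat.card F) (m : ℕ) (hm : 1 ≤ m) :
    ∃ h : ℕ → Fin (3 * m + 4) → F, ∀ n, Nat.card J * Nat.card F ^ m ≤ n →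
      Function.Surjective (syndromeMap (F := F) h n) ∧
      coveringRadius (LinearMap.ker (syndromeMap (F := F) h n)) = 3 := by
  have := Fintype.ofFinite F
  have := Fintype.ofFinite J
  obtain ⟨β⟩ : Nonempty (J ↪ F) := Function.Embedding.nonempty_of_card_le (by
    rwa [← Nat.card_eq_fintype_card, ← Nat.card_eq_fintype_card])
  obtain ⟨L⟩ : Nonempty (((Fin 4 → F) × (Fin m → F) × (Fin m → F) × (Fin m → F)) ≃ₗ[F]
      (Fin (3 * m + 4) → F)) := ⟨LinearEquiv.ofFinrankEq _ _ (by
    rw [finrank_concat, Module.finrank_fin_fun])⟩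
  have hcard : Nat.card (J × (Fin m → F)) = Nat.card J * Nat.card F ^ m := by
    simp
  let e : Fin (Nat.card J * Nat.card F ^ m) ≃ J × (Fin m → F) :=
    (finCongr hcard.symm).trans (Finite.equivFin _).symm
  have hpos : 0 < Nat.card J * Nat.card F ^ m := by
    obtain ⟨j, -⟩ := hg 0
    have : Nonempty J := ⟨j⟩
    exact Nat.mul_pos Nat.card_pos (pow_pos Nat.card_pos _)
  -- The columns repeat periodically, so every initial segment at least one period long contains all
  -- of them.
  let π : ℕ → J × (Fin m → F) := fun n => e ⟨n % _, Nat.mod_lt n hpos⟩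
  have hπ : ∀ x, π (e.symm x) = x := fun x => by
    simp only [π, Nat.mod_eq_of_lt (e.symm x).2, Fin.eta, Equiv.apply_symm_apply]
  refine ⟨fun n => L (concatColumn g β (π n)), fun n hn => ?_⟩
  have hcov : ∀ s : Fin (3 * m + 4) → F, ∃ (j₁ j₂ j₃ : Fin n) (a b c : F),
      s = a • L (concatColumn g β (π j₁)) + b • L (concatColumn g β (π j₂))
        + c • L (concatColumn g β (π j₃)) := by
    intro s
    obtain ⟨x₁, x₂, x₃, a, b, c, hs⟩ := concatColumn_three β.injective hg (L.symm s)
    refine ⟨(e.symm x₁).castLE hn, (e.symm x₂).castLE hn, (e.symm x₃).castLE hn, a, b, c, ?_⟩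
    simp only [Fin.val_castLE, hπ, ← map_smul, ← map_add, ← hs, LinearEquiv.apply_symm_apply]
  refine ⟨syndromeMap_surjective hcov, coveringRadius_ker_syndromeMap hcov ?_⟩
  obtain ⟨s, hs⟩ := exists_not_two (F := F) (fun x => L (concatColumn g β (m := m) x)) (by
    have hV : Nat.card (Fin (3 * m + 4) → F) = Nat.card F ^ (3 * m + 4) := by simp
    rw [hcard, hV]
    calc (Nat.card F * (Nat.card J * Nat.card F ^ m)) ^ 2
        ≤ (Nat.card F * (Nat.card F * Nat.card F ^ m)) ^ 2 := by gcongr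
      _ = Nat.card F ^ (2 * m + 4) := by ring
      _ < Nat.card F ^ (3 * m + 4) := Nat.pow_lt_pow_right Finite.one_lt_card (by omega))
  exact ⟨s, fun i j a b => hs _ _ a b⟩

end Concatenation

/-! ### Sphere sizes and the limiting density -/

section Density

open Classical in
-- A vector of weight `i` is given by its support and the nonzero values there; an upper bound is
-- all the density estimate needs.
theorem sphereSize_le (F : Type*) [Field F] [Finite F] (n R : ℕ) :
    sphereSize F n R ≤ ∑ i ∈ Finset.range (R + 1), n.choose i * (Nat.card F - 1) ^ i := by
  have := Fintype.ofFinite F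
  let B : Finset (Fin n → F) := (Finset.range (R + 1)).biUnion fun i =>
    (Finset.univ.powersetCard i).biUnion fun s : Finset (Fin n) =>
      Fintype.piFinset fun j => if j ∈ s then {0}ᶜ else {0}
  have hB : ∀ v : Fin n → F, hammingDist v 0 ≤ R → v ∈ B := by
    intro v hv
    rw [hammingDist_zero_right] at hv
    refine Finset.mem_biUnion.2 ⟨hammingNorm v, Finset.mem_range.2 (by omega),
      Finset.mem_biUnion.2 ⟨Finset.univ.filter fun j => v j ≠ 0,
        Finset.mem_powersetCard.2 ⟨Finset.subset_univ _, rfl⟩, Fintype.mem_piFinset.2 fun j => ?_⟩⟩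
    by_cases h : v j = 0 <;> simp [h]
  calc sphereSize F n R = Nat.card {v : Fin n → F // hammingDist v 0 ≤ R} := rfl
    _ ≤ Nat.card B := Nat.card_le_card_of_injective (fun v => (⟨v.1, hB v.1 v.2⟩ : B))
        fun v w h => Subtype.ext (congrArg (fun z : B => (z : Fin n → F)) h)
    _ = B.card := by simp
    _ ≤ ∑ i ∈ Finset.range (R + 1), ∑ s ∈ (Finset.univ : Finset (Fin n)).powersetCard i,
          (Fintype.piFinset fun j => if j ∈ s then ({0}ᶜ : Finset F) else {0}).card :=
        Finset.card_biUnion_le.trans (Finset.sum_le_sum fun i _ => Finset.card_biUnion_le)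
    _ = ∑ i ∈ Finset.range (R + 1), n.choose i * (Nat.card F - 1) ^ i := by
        refine Finset.sum_congr rfl fun i _ => ?_
        have : ∀ s ∈ (Finset.univ : Finset (Fin n)).powersetCard i,
            (Fintype.piFinset fun j => if j ∈ s then ({0}ᶜ : Finset F) else {0}).card =
              (Nat.card F - 1) ^ i := by
          intro s hs
          rw [Fintype.card_piFinset]
          simp only [apply_ite Finset.card, Finset.card_compl, Finset.card_singleton]
          rw [Finset.prod_ite, Finset.prod_const, Finset.prod_const_one, mul_one,
            Nat.card_eq_fintype_card]
          congr 1
          simpa using (Finset.mem_powersetCard.1 hs).2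
        rw [Finset.sum_congr rfl this, Finset.sum_const, Finset.card_powersetCard,
          Finset.card_univ, Fintype.card_fin, smul_eq_mul]

theorem sphereSize_three_le (F : Type*) [Field F] [Finite F] (n : ℕ) :
    (sphereSize F n 3 : ℝ) ≤ 1 + (Nat.card F - 1) * n + (Nat.card F - 1) ^ 2 * n ^ 2 / 2
      + (Nat.card F - 1) ^ 3 * n ^ 3 / 6 := by
  have h : (sphereSize F n 3 : ℝ) ≤
      ((∑ i ∈ Finset.range 4, n.choose i * (Nat.card F - 1) ^ i : ℕ) : ℝ) := by
    exact_mod_cast sphereSize_le F n 3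
  refine h.trans ?_
  have h1 : 1 ≤ Nat.card F := Nat.card_pos
  have hq : (0 : ℝ) ≤ (Nat.card F : ℝ) - 1 := by
    have : (1 : ℝ) ≤ Nat.card F := by exact_mod_cast h1
    linarith
  have h2 := Nat.choose_le_pow_div (α := ℝ) 2 n
  have h3 := Nat.choose_le_pow_div (α := ℝ) 3 n
  have e2 : ((Nat.factorial 2 : ℕ) : ℝ) = 2 := by norm_num [Nat.factorial]
  have e3 : ((Nat.factorial 3 : ℕ) : ℝ) = 6 := by norm_num [Nat.factorial]
  rw [e2] at h2
  rw [e3] at h3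
  have h2' := mul_le_mul_of_nonneg_right h2 (pow_nonneg hq 2)
  have h3' := mul_le_mul_of_nonneg_right h3 (pow_nonneg hq 3)
  simp only [Finset.sum_range_succ, Finset.sum_range_zero]
  push_cast [Nat.cast_sub h1]
  simp only [Nat.choose_zero_right, Nat.choose_one_right, pow_zero, pow_one, Nat.cast_one]
  linarith

/-- The limiting density along the lengths `N * q ^ m`, where `x = 1 / q'`. -/
theorem limit_density_lt {x : ℝ} (hx0 : 0 < x) (hx : x ≤ 1 / 4) :
    32 / 3 * ((1 - x ^ 3) ^ 3 * (1 + x) ^ 3) < 32 / 3 + 32 * x + 32 * x ^ 2 - 64 / 3 * x ^ 3 := by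
  have h3 : 0 < x ^ 3 := by positivity
  have hx2 : x ^ 2 ≤ 1 / 16 := by nlinarith
  have hx3 : x ^ 3 ≤ 1 / 64 := by nlinarith
  -- Since `(1 - x³)³ = 1 - x³ (3 - 3 x³ + x⁶)`, and the right side of the goal is `32/3 * ((1 + x)³
  -- - 3 x³)`, the claim reduces to this.
  have key : 3 < (1 + x) ^ 3 * (3 - 3 * x ^ 3 + x ^ 6) := by
    have h1 : 1 + 3 * x ≤ (1 + x) ^ 3 := by nlinarith [sq_nonneg x]
    have h2 : 3 - 3 * x ^ 3 ≤ 3 - 3 * x ^ 3 + x ^ 6 := by nlinarith [sq_nonneg (x ^ 3)]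
    have h4 : 3 < (1 + 3 * x) * (3 - 3 * x ^ 3) := by nlinarith
    refine h4.trans_le (mul_le_mul h1 h2 (by linarith) (by positivity))
  have : (1 - x ^ 3) ^ 3 * (1 + x) ^ 3 =
      (1 + x) ^ 3 - x ^ 3 * ((1 + x) ^ 3 * (3 - 3 * x ^ 3 + x ^ 6)) := by ring
  nlinarith [mul_lt_mul_of_pos_left key h3]

/-- The liminf over all lengths is at most any bound that holds infinitely often, so only the
lengths `N * q ^ m` matter. -/
theorem lowerDensity_lt_of_frequently {F : Type*} [Field F] [Finite F] {q' : ℕ} (hq' : 4 ≤ q')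
    (hF : Nat.card F = q' ^ 3) (A : InfiniteFamily F 3)
    (hA : ∀ m : ℕ, 1 ≤ m →
      codimension (A.code (4 * (q' + 1) * Nat.card F ^ m)) = 3 * m + 4) :
    A.lowerDensity < ((32 / 3 + 32 * (q' : ℝ)⁻¹ + 32 * (q' : ℝ)⁻¹ ^ 2
      - 64 / 3 * (q' : ℝ)⁻¹ ^ 3 : ℝ) : EReal) := by
  have hq0 : (4 : ℝ) ≤ q' := by exact_mod_cast hq'
  have hqpos : (0 : ℝ) < q' := by linarith
  have hFr : (Nat.card F : ℝ) = (q' : ℝ) ^ 3 := by exact_mod_cast hF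
  have hQ : (1 : ℝ) < Nat.card F := by exact_mod_cast (Finite.one_lt_card : 1 < Nat.card F)
  set Q : ℝ := (Nat.card F : ℝ) with hQdef
  have hQpos : 0 < Q := by linarith
  set N : ℝ := 4 * (q' + 1) with hN
  -- The sphere bound at `n = N * Q ^ m` divided by `Q ^ (3 * m + 4)`, as a polynomial in `y = Q⁻¹ ^
  -- m`; the limit is its value at 0.
  let P : ℝ → ℝ := fun y => (y ^ 3 + (Q - 1) * N * y ^ 2 + (Q - 1) ^ 2 * N ^ 2 / 2 * y
    + (Q - 1) ^ 3 * N ^ 3 / 6) / Q ^ 4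
  have hbound : ∀ m : ℕ, 1 ≤ m → A.density (4 * (q' + 1) * Nat.card F ^ m) ≤ P (Q⁻¹ ^ m) := by
    intro m hm
    unfold InfiniteFamily.density
    rw [hA m hm, ← hQdef, div_le_iff₀ (by positivity)]
    refine (sphereSize_three_le F _).trans (le_of_eq ?_)
    push_cast
    rw [← hQdef, ← hN]
    have hQm : Q ^ m ≠ 0 := by positivity
    have e : Q ^ (3 * m + 4) = (Q ^ m) ^ 3 * Q ^ 4 := by ring
    simp only [P, e, inv_pow]
    field_simp
  have hlim : Tendsto (fun m : ℕ => P (Q⁻¹ ^ m)) atTop (nhds (P 0)) := by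
    have hc : Continuous P := by fun_prop
    exact (hc.tendsto 0).comp
      (tendsto_pow_atTop_nhds_zero_of_lt_one (by positivity) (inv_lt_one_of_one_lt₀ hQ))
  have hP0 : P 0 < 32 / 3 + 32 * (q' : ℝ)⁻¹ + 32 * (q' : ℝ)⁻¹ ^ 2 - 64 / 3 * (q' : ℝ)⁻¹ ^ 3 := by
    refine lt_of_eq_of_lt ?_ (limit_density_lt (x := (q' : ℝ)⁻¹) (by positivity) (by
      rw [one_div]
      exact inv_anti₀ (by norm_num) hq0))
    simp only [P, hFr, hN]
    field_simp
    ring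
  obtain ⟨c, hc1, hc2⟩ := exists_between hP0
  refine lt_of_le_of_lt (b := (c : EReal)) ?_ (by exact_mod_cast hc2)
  refine liminf_le_of_frequently_le' ?_
  have htend : Tendsto (fun m : ℕ => 4 * (q' + 1) * Nat.card F ^ m) atTop atTop := by
    refine tendsto_atTop_mono (fun m => ?_)
      (tendsto_pow_atTop_atTop_of_one_lt (Finite.one_lt_card : 1 < Nat.card F))
    exact Nat.le_mul_of_pos_left _ (by omega)
  refine htend.frequently (Eventually.frequently ?_)
  filter_upwards [hlim.eventually_lt_const hc1, eventually_ge_atTop 1] with m hm h1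
  exact_mod_cast (hbound m h1).trans hm.le

end Density

/-! ### Assembling the levels into one family -/

section Family

/-- Identifies `Nat.log q (n / N)` as the level of `n`. Without `N ≤ n` the case `m = 0` would fail,
because `Nat.log q 0 = 0`. -/
theorem le_log_div_iff {q N n m : ℕ} (hN : 0 < N) (hq : 1 < q) (hn : N ≤ n) :
    m ≤ Nat.log q (n / N) ↔ N * q ^ m ≤ n := by
  rw [Nat.le_log_iff_pow_le hq (Nat.div_pos hn hN).ne', Nat.le_div_iff_mul_le hN, mul_comm]

theorem one_le_log_div {q N n : ℕ} (hN : 0 < N) (hq : 1 < q) (hn : N * q ≤ n) :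
    1 ≤ Nat.log q (n / N) :=
  (le_log_div_iff hN hq ((Nat.le_mul_of_pos_right N (by omega)).trans hn)).2 (by rwa [pow_one])

theorem mul_pow_log_div_le {q N n : ℕ} (hN : 0 < N) (hq : 1 < q) (hn : N * q ≤ n) :
    N * q ^ Nat.log q (n / N) ≤ n :=
  (le_log_div_iff hN hq ((Nat.le_mul_of_pos_right N (by omega)).trans hn)).1 le_rfl

variable {F : Type*} [Field F] {q N : ℕ}

/-- The code of length `n` defined by the first `n` columns of the sequence `h m`, where
`N * q ^ m ≤ n < N * q ^ (m + 1)`. -/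
noncomputable def levelCode (q N : ℕ) (h : ∀ m : ℕ, ℕ → Fin (3 * m + 4) → F) (n : ℕ) :
    Submodule F (Fin n → F) :=
  LinearMap.ker (syndromeMap (F := F) (h (Nat.log q (n / N))) n)

theorem codimension_levelCode (hN : 0 < N) (hq : 1 < q) {h : ∀ m : ℕ, ℕ → Fin (3 * m + 4) → F}
    (hh : ∀ m, 1 ≤ m → ∀ n, N * q ^ m ≤ n → Function.Surjective (syndromeMap (F := F) (h m) n))
    {n : ℕ} (hn : N * q ≤ n) :
    codimension (levelCode q N h n) = 3 * Nat.log q (n / N) + 4 := by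
  rw [levelCode, codimension_ker_of_surjective
    (hh _ (one_le_log_div hN hq hn) n (mul_pow_log_div_le hN hq hn)), Module.finrank_fin_fun]

/-- The infinite family formed by the codes `levelCode q N h n` of lengths `n ≥ N * q`. -/
noncomputable def levelFamily (hN : 3 ≤ N) (hq : 1 < q)
    (h : ∀ m : ℕ, ℕ → Fin (3 * m + 4) → F)
    (hh : ∀ m, 1 ≤ m → ∀ n, N * q ^ m ≤ n → Function.Surjective (syndromeMap (F := F) (h m) n))
    (hR : ∀ m, 1 ≤ m → ∀ n, N * q ^ m ≤ n →
      coveringRadius (LinearMap.ker (syndromeMap (F := F) (h m) n)) = 3) :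
    InfiniteFamily F 3 where
  start := N * q
  code := levelCode q N h
  le_start := by nlinarith
  coveringRadius_eq n hn :=
    hR _ (one_le_log_div (by omega) hq hn) n (mul_pow_log_div_le (by omega) hq hn)
  codimension_le n hn := by
    rw [codimension_levelCode (by omega) hq hh hn, codimension_levelCode (by omega) hq hh (by omega)]
    have : Nat.log q (n / N) ≤ Nat.log q ((n + 1) / N) :=
      Nat.log_mono_right (Nat.div_le_div_right (by omega))
    omega
  filling n hn he := by
    rw [codimension_levelCode (by omega) hq hh hn,
      codimension_levelCode (by omega) hq hh (by omega)] at he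
    have he' : Nat.log q ((n + 1) / N) = Nat.log q (n / N) := by omega
    have h1 := one_le_log_div (by omega) hq hn
    have h2 := mul_pow_log_div_le (by omega) hq hn
    unfold levelCode
    rw [he']
    exact isOneExtension_ker_syndromeMap _ n (hh _ h1 n h2) (hh _ h1 (n + 1) (by omega))

variable (hN : 3 ≤ N) (hq : 1 < q) (h : ∀ m : ℕ, ℕ → Fin (3 * m + 4) → F)
    (hh : ∀ m, 1 ≤ m → ∀ n, N * q ^ m ≤ n → Function.Surjective (syndromeMap (F := F) (h m) n))
    (hR : ∀ m, 1 ≤ m → ∀ n, N * q ^ m ≤ n →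
      coveringRadius (LinearMap.ker (syndromeMap (F := F) (h m) n)) = 3)

theorem codimension_levelFamily_mul_pow {m : ℕ} (hm : 1 ≤ m) :
    codimension ((levelFamily hN hq h hh hR).code (N * q ^ m)) = 3 * m + 4 := by
  refine (codimension_levelCode (by omega) hq hh ?_).trans ?_
  · exact Nat.mul_le_mul_left _ (Nat.le_self_pow (by omega) q)
  · rw [Nat.mul_div_cancel_left _ (by omega), Nat.log_pow hq]

/-- The codimension depends only on the level, which increases exactly on reaching a length `N * q ^
m`; the value `m = 1` is the start of the family. -/
theorem isSupporting_levelFamily_iff (n : ℕ) :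
    (levelFamily hN hq h hh hR).IsSupporting n ↔ ∃ m, 1 ≤ m ∧ n = N * q ^ m := by
  have hN0 : 0 < N := by omega
  constructor
  · rintro (hs | ⟨hlt, hcod⟩)
    · exact ⟨1, le_rfl, by simpa [levelFamily] using hs⟩
    · change N * q < n at hlt
      change codimension (levelCode q N h (n - 1)) < codimension (levelCode q N h n) at hcod
      rw [codimension_levelCode hN0 hq hh (by omega),
        codimension_levelCode hN0 hq hh hlt.le] at hcod
      refine ⟨Nat.log q (n / N), one_le_log_div hN0 hq hlt.le, le_antisymm ?_
        (mul_pow_log_div_le hN0 hq hlt.le)⟩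
      -- If `n` exceeded the first length of its level, `n - 1` would already have that level, and
      -- there would be no jump.
      by_contra hcon
      have hNq : N ≤ N * q := Nat.le_mul_of_pos_right N (by omega)
      have := (le_log_div_iff (m := Nat.log q (n / N)) hN0 hq
        (show N ≤ n - 1 by omega)).2 (by omega)
      omega
  · rintro ⟨m, hm, rfl⟩
    rcases hm.eq_or_lt with rfl | hm'
    · exact Or.inl (by simp [levelFamily])
    · have hlt : N * q < N * q ^ m := by
        refine Nat.mul_lt_mul_of_pos_left ?_ hN0
        simpa using Nat.pow_lt_pow_right hq hm'
      refine Or.inr ⟨hlt, ?_⟩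
      rw [codimension_levelFamily_mul_pow hN hq h hh hR hm]
      change codimension (levelCode q N h (N * q ^ m - 1)) < _
      rw [codimension_levelCode hN0 hq hh (by omega)]
      have hNq : N ≤ N * q := Nat.le_mul_of_pos_right N (by omega)
      have := (le_log_div_iff (m := m) (n := N * q ^ m - 1) hN0 hq (by omega)).not.2 (by omega)
      omega

end Family

/-- The exponent is `m + 1 / 3`, and the extra factor `q ^ (1 / 3) = q'` turns `4 + 4 / q'` into `4
* (q' + 1)`. -/
theorem length_formula {q q' : ℕ} (hq' : 0 < q') (hq : q = q' ^ 3) {r m : ℕ} (hr : r = 3 * m + 4) :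
    ((4 * (q' + 1) * q ^ m : ℕ) : ℝ) =
      (4 + 4 / (q : ℝ) ^ ((1 : ℝ) / 3)) * (q : ℝ) ^ (((r : ℝ) - 3) / 3) := by
  have hpos : (0 : ℝ) < q' := by exact_mod_cast hq'
  have hroot : (q : ℝ) ^ ((1 : ℝ) / 3) = q' := by
    rw [hq, Nat.cast_pow, ← Real.rpow_natCast, ← Real.rpow_mul hpos.le]
    norm_num
  have hqpos : (0 : ℝ) < q := by rw [hq]; positivity
  have he : ((r : ℝ) - 3) / 3 = (m : ℝ) + 1 / 3 := by
    rw [hr]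
    push_cast
    ring
  rw [he, Real.rpow_add hqpos, hroot, Real.rpow_natCast]
  push_cast
  field_simp

theorem mainTheorem10 (F : Type*) [Field F] [Finite F] (q q' : ℕ) (hF : Nat.card F = q)
    (hq : q = q' ^ 3) (h64 : 64 ≤ q) :
    ∃ A : InfiniteFamily F 3,
      (∀ n : ℕ, A.IsSupporting n →
        ∃ r t : ℕ, r = 3 * t + 1 ∧ 7 ≤ r ∧ codimension (A.code n) = r ∧
          (n : ℝ) = (4 + 4 / (q : ℝ) ^ ((1 : ℝ) / 3)) * (q : ℝ) ^ (((r : ℝ) - 3) / 3)) ∧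
      (∀ r t : ℕ, r = 3 * t + 1 → 7 ≤ r →
        ∃ n : ℕ, A.IsSupporting n ∧ codimension (A.code n) = r ∧
          (n : ℝ) = (4 + 4 / (q : ℝ) ^ ((1 : ℝ) / 3)) * (q : ℝ) ^ (((r : ℝ) - 3) / 3)) ∧
      A.lowerDensity <
        ((32 / 3 + 32 / (q : ℝ) ^ ((1 : ℝ) / 3) + 32 / (q : ℝ) ^ ((2 : ℝ) / 3)
          - 64 / (3 * (q : ℝ)) : ℝ) : EReal) := by
  have hq4 : 4 ≤ q' := by
    by_contra hlt
    have : q' ^ 3 ≤ 3 ^ 3 := Nat.pow_le_pow_left (by omega) 3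
    omega
  obtain ⟨K, _, _, _, hK, hKF⟩ := exists_cubic_subfield F q' (hF.trans hq)
  obtain ⟨d, hd⟩ := exists_forall_sq_sub_ne K
  have hJ : Nat.card (Fin 4 × Option K) = 4 * (q' + 1) := by
    rw [Nat.card_prod, Nat.card_fin, Finite.card_option, hK]
  -- Distinct scalars `β j` require `4 * (q' + 1) ≤ q' ^ 3`, which holds for `q' ≥ 4`.
  have hJq : Nat.card (Fin 4 × Option K) ≤ Nat.card F := by
    rw [hJ, hF, hq]
    nlinarith [Nat.mul_le_mul hq4 hq4]
  choose h hh using exists_columns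
    (isProperTriple_sublinePoint (F := F) (by omega) hKF hd) hJq
  rw [hJ, hF] at hh
  -- The value at `m = 0` is a dummy: the family begins at level 1, codimension 7.
  let h' : ∀ m : ℕ, ℕ → Fin (3 * m + 4) → F := fun m => if hm : 1 ≤ m then h m hm else 0
  have hh' : ∀ m, ∀ hm : 1 ≤ m, h' m = h m hm := fun m hm => dif_pos hm
  have hN : 3 ≤ 4 * (q' + 1) := by omega
  have hq1 : 1 < q := by omega
  have hs : ∀ m, 1 ≤ m → ∀ n, 4 * (q' + 1) * q ^ m ≤ n →
      Function.Surjective (syndromeMap (F := F) (h' m) n) := fun m hm n hn => by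
    rw [hh' m hm]
    exact (hh m hm n hn).1
  have hR : ∀ m, 1 ≤ m → ∀ n, 4 * (q' + 1) * q ^ m ≤ n →
      coveringRadius (LinearMap.ker (syndromeMap (F := F) (h' m) n)) = 3 := fun m hm n hn => by
    rw [hh' m hm]
    exact (hh m hm n hn).2
  refine ⟨levelFamily hN hq1 h' hs hR, ?_, ?_, ?_⟩
  · intro n hn
    obtain ⟨m, hm, rfl⟩ := (isSupporting_levelFamily_iff hN hq1 h' hs hR n).1 hn
    exact ⟨3 * m + 4, m + 1, by ring, by omega,
      codimension_levelFamily_mul_pow hN hq1 h' hs hR hm, length_formula (by omega) hq rfl⟩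
  · intro r t hr h7
    obtain ⟨m, rfl⟩ : ∃ m, t = m + 1 := ⟨t - 1, by omega⟩
    have hm : 1 ≤ m := by omega
    have hr' : r = 3 * m + 4 := by omega
    exact ⟨4 * (q' + 1) * q ^ m,
      (isSupporting_levelFamily_iff hN hq1 h' hs hR _).2 ⟨m, hm, rfl⟩,
      (codimension_levelFamily_mul_pow hN hq1 h' hs hR hm).trans hr'.symm,
      length_formula (by omega) hq hr'⟩
  · refine lt_of_lt_of_eq (lowerDensity_lt_of_frequently hq4 (hF.trans hq) _ fun m hm => ?_) ?_
    · rw [hF]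
      exact codimension_levelFamily_mul_pow hN hq1 h' hs hR hm
    · have hpos : (0 : ℝ) ≤ q' := Nat.cast_nonneg _
      have h1 : (q : ℝ) ^ ((1 : ℝ) / 3) = q' := by
        rw [hq, Nat.cast_pow, ← Real.rpow_natCast, ← Real.rpow_mul hpos]
        norm_num
      have h2 : (q : ℝ) ^ ((2 : ℝ) / 3) = (q' : ℝ) ^ 2 := by
        rw [hq, Nat.cast_pow, ← Real.rpow_natCast, ← Real.rpow_mul hpos]
        norm_num
      have h3 : (q : ℝ) = (q' : ℝ) ^ 3 := by exact_mod_cast hq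
      rw [h1, h2, h3]
      congr 1
      have : (q' : ℝ) ≠ 0 := by
        have : (4 : ℝ) ≤ q' := by exact_mod_cast hq4
        linarith
      field_simp
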